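/- **Setting (contextual BTL model).** Let $\psi(t)=1/(1+e^{-t})$, $n,L\ge 1$, $B>0$, $p\in(0,1]$, and let $\mathbb X\subset\mathbb R^d$ be compact. Let $$\Theta=\{\boldsymbol\theta:\ \theta_i(\mathbf x)\in[-B,B]\text{ for all }i\in[n],\ \textstyle\sum_{i}\theta_i(\mathbf x)=0,\ \text{for all }\mathbf x\in\mathbb X\},$$ and let $\boldsymbol\theta^*\in\Theta$ be measurable. The comparison graph $\mathbf A$ is an Erdős–Rényi graph on $[n]$ with connection probability $p$; let $\mathcal E(\mathbf A)$ be its set of edges $(i,j)$, $i>j$, and $|\mathbf A|$ their number. For each edge $(i,j)$ and $\ell\in[L]$ we observe $(\mathbf X_{ij\ell},Y_{ij\ell})$, where the contexts are drawn from a law supported on $\mathbb X$, $\mathbb P(Y_{ij\ell}=1\mid \mathbf X_{ij\ell}=\mathbf x)=\psi(\theta^*_i(\mathbf x)-\theta^*_j(\mathbf x))=1-\mathbb P(Y_{ij\ell}=0\mid \mathbf X_{ij\ell}=\mathbf x)$, and all the pairs $(\mathbf X_{ij\ell},Y_{ij\ell})$ and $\mathbf A$ are independent. Let $\mathcal D_n$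 be the observed data, and let $\mathbf X$ be a further context with the same law, independent of $(\mathbf A,\mathcal D_n)$. For a class $\mathcal F$ of real functions of the context let $\mathcal G(\mathcal F^n)=\{\boldsymbol\vartheta-\tfrac1n\mathbf 1\mathbf 1^\top\boldsymbol\vartheta:\ \boldsymbol\vartheta\in\mathcal F^n\cap\Theta\}$, and let $\hat{\boldsymbol\theta}$, a measurable function of $(\mathbf A,\mathcal D_n)$ and of the context, be (almost surely) a minimizer over $\mathcal G(\mathcal F^n)$ of $$-\frac1{n^2pL}\sum_{(i,j)\in\mathcal E(\mathbf A),\,\ell\in[L]}\Big\{Y_{ij\ell}\log\psi\big(\theta_i(\mathbf X_{ij\ell})-\theta_j(\mathbf X_{ij\ell})\big)+(1-Y_{ij\ell})\log\big(1-\psi(\theta_i(\mathbf X_{ij\ell})-\theta_j(\mathbf X_{ij\ell}))\big)\Big\}.$$ For scores $\boldsymbol\theta$, items $i_0,j_0\in[n]$ and measurable $\Omega\subseteq\mathbb X$, define the potential $$\boldsymbol\pi(\mathbf x\mid\boldsymbol\theta,i_0,j_0,\Omega)=\mathbb I(\mathbf x\in\Omega)\,|\mathbf A|\,\mathscr L^\dagger(\mathbf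 x\mid\boldsymbol\theta)(\mathbf e_{i_0}-\mathbf e_{j_0}),\qquad \mathscr L(\mathbf x\mid\boldsymbol\theta)=\mathrm{diag}(\boldsymbol\Xi\mathbf 1)-\boldsymbol\Xi,\quad \Xi_{ij}=A_{ij}\,\psi'(\theta_i(\mathbf x)-\theta_j(\mathbf x)),$$ where $\dagger$ is the Moore–Penrose inverse, and let $\hat{\boldsymbol\pi}$ and $\boldsymbol\pi^*$ be the potentials of $\hat{\boldsymbol\theta}$ and $\boldsymbol\theta^*$. **Proposition (Oracle inequality of potential vector).** For every $B>0$ there is a constant $C>0$, depending only on $B$, such that in every setting as above with $np\ge 40\log n$, with probability at least $1-4/n$ (over $\mathbf A$), $$\sup_{i_0,j_0\in[n],\ \Omega\subseteq\mathbb X}\ \frac1n\,\mathbb E\Big(\big\|\hat{\boldsymbol\pi}(\mathbf X\mid i_0,j_0,\Omega)-\boldsymbol\pi^*(\mathbf X\mid i_0,j_0,\Omega)\big\|_2^2\ \Big|\ \mathbf A\Big)\ \le\ C\, n\ \mathbb E\Big(\big\|\hat{\boldsymbol\theta}(\mathbf X)-\boldsymbol\theta^*(\mathbf X)\big\|_\infty^2\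 \Big|\ \mathbf A\Big),$$ where the supremum is over measurable $\Omega$ and $\|\cdot\|_\infty$ is the vector max norm. -/

import Mathlib

open MeasureTheory ProbabilityTheory Matrix
open scoped ENNReal unitInterval

namespace FisherWalk

/-! ### Moore–Penrose inverse of a real square matrix -/

/-- `N` satisfies the four Penrose equations for the real square matrix `M`. -/
structure IsMoorePenrose {ι : Type*} [Fintype ι] (M N : Matrix ι ι ℝ) : Prop where
  mul_mul_left : M * N * M = M
  mul_mul_right : N * M * N = N
  symm_left : (M * N)ᵀ = M * N
  symm_right : (N * M)ᵀ = N * M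

theorem IsMoorePenrose.unique {ι : Type*} [Fintype ι] {M N₁ N₂ : Matrix ι ι ℝ}
    (h₁ : IsMoorePenrose M N₁) (h₂ : IsMoorePenrose M N₂) : N₁ = N₂ := by
  have e1 : M * N₁ = M * N₂ := by
    calc M * N₁ = (M * N₂ * M) * N₁ := by rw [h₂.mul_mul_left]
      _ = (M * N₂) * (M * N₁) := by simp only [Matrix.mul_assoc]
      _ = (M * N₂)ᵀ * (M * N₁)ᵀ := by rw [h₂.symm_left, h₁.symm_left]
      _ = ((M * N₁ * M) * N₂)ᵀ := by rw [← Matrix.transpose_mul]; simp only [Matrix.mul_assoc]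
      _ = M * N₂ := by rw [h₁.mul_mul_left, h₂.symm_left]
  have e2 : N₁ * M = N₂ * M := by
    calc N₁ * M = N₁ * (M * N₂ * M) := by rw [h₂.mul_mul_left]
      _ = (N₁ * M) * (N₂ * M) := by simp only [Matrix.mul_assoc]
      _ = (N₁ * M)ᵀ * (N₂ * M)ᵀ := by rw [h₁.symm_right, h₂.symm_right]
      _ = (N₂ * (M * N₁ * M))ᵀ := by rw [← Matrix.transpose_mul]; simp only [Matrix.mul_assoc]
      _ = N₂ * M := by rw [h₁.mul_mul_left, h₂.symm_right]
  calc N₁ = N₁ * M * N₁ := h₁.mul_mul_right.symm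
    _ = N₂ * (M * N₁) := by rw [e2, Matrix.mul_assoc]
    _ = N₂ := by rw [e1, ← Matrix.mul_assoc, h₂.mul_mul_right]

/-- A real symmetric matrix has a Moore–Penrose inverse: invert its nonzero eigenvalues. -/
theorem exists_isMoorePenrose {ι : Type*} [Fintype ι] [DecidableEq ι] {M : Matrix ι ι ℝ}
    (hM : M.IsHermitian) : ∃ N, IsMoorePenrose M N := by
  obtain ⟨U, D, hU, hMD⟩ : ∃ (U : Matrix ι ι ℝ) (D : ι → ℝ),
      Uᵀ * U = 1 ∧ M = U * diagonal D * Uᵀ := by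
    refine ⟨hM.eigenvectorUnitary, hM.eigenvalues, ?_, ?_⟩
    · have := Unitary.coe_star_mul_self hM.eigenvectorUnitary
      simpa [star_eq_conjTranspose, conjTranspose_eq_transpose_of_trivial] using this
    · have := hM.spectral_theorem
      rw [Unitary.conjStarAlgAut_apply] at this
      simpa [star_eq_conjTranspose, conjTranspose_eq_transpose_of_trivial,
        Function.comp_def] using this
  have key : ∀ a b : ι → ℝ, (U * diagonal a * Uᵀ) * (U * diagonal b * Uᵀ)
      = U * diagonal (fun i => a i * b i) * Uᵀ := by
    intro a b
    calc (U * diagonal a * Uᵀ) * (U * diagonal b * Uᵀ)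
        = U * diagonal a * (Uᵀ * U) * diagonal b * Uᵀ := by simp only [Matrix.mul_assoc]
      _ = U * (diagonal a * diagonal b) * Uᵀ := by
          rw [hU, Matrix.mul_one]; simp only [Matrix.mul_assoc]
      _ = _ := by rw [diagonal_mul_diagonal]
  have tr : ∀ a : ι → ℝ, (U * diagonal a * Uᵀ)ᵀ = U * diagonal a * Uᵀ := by
    intro a
    simp [Matrix.transpose_mul, Matrix.mul_assoc]
  refine ⟨U * diagonal (fun i => (D i)⁻¹) * Uᵀ, ?_, ?_, ?_, ?_⟩
  · rw [hMD, key, key]; simp [mul_inv_mul_cancel]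
  · rw [hMD, key, key]
    congr 3
    funext i
    by_cases h : D i = 0 <;> simp [h]
  · rw [hMD, key, tr]
  · rw [hMD, key, tr]

open Classical in
/-- The Moore–Penrose inverse `M†`. -/
noncomputable def pinv {ι : Type*} [Fintype ι] (M : Matrix ι ι ℝ) : Matrix ι ι ℝ :=
  if h : ∃ N, IsMoorePenrose M N then h.choose else 0

theorem isMoorePenrose_pinv {ι : Type*} [Fintype ι] [DecidableEq ι] {M : Matrix ι ι ℝ}
    (hM : M.IsHermitian) : IsMoorePenrose M (pinv M) := by
  have h := exists_isMoorePenrose hM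
  rw [pinv, dif_pos h]
  exact h.choose_spec

/-! ### Contexts, score functions, weighted Laplacian and potential -/

/-- The ambient space of the contexts. -/
abbrev Ctx (d : ℕ) : Type := EuclideanSpace ℝ (Fin d)

/-- A vector `θ(·) = (θ₁(·), …, θₙ(·))` of score functions of the context. -/
abbrev Scores (n d : ℕ) : Type := Ctx d → Fin n → ℝ

/-- The class `Θ`: scores with values in `[-B, B]` and sum zero on the context domain `𝕏`. -/
def scoreClass (n d : ℕ) (B : ℝ) (𝕏 : Set (Ctx d)) : Set (Scores n d) :=
  {θ | ∀ x ∈ 𝕏, (∀ i, θ x i ∈ Set.Icc (-B) B) ∧ ∑ i, θ x i = 0}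

open Classical in
/-- The matrix `Ξ = [A_ij ψ'(t_i - t_j)]`, for the value `t ∈ ℝⁿ` of the scores at a context, where
`ψ` is the logistic function. -/
noncomputable def fisherWeight {n : ℕ} (G : SimpleGraph (Fin n)) (t : Fin n → ℝ) :
    Matrix (Fin n) (Fin n) ℝ :=
  Matrix.of fun i j => if G.Adj i j then deriv Real.sigmoid (t i - t j) else 0

/-- The weighted graph Laplacian `diag(Ξ 1) - Ξ`. -/
noncomputable def fisherLaplacian {n : ℕ} (G : SimpleGraph (Fin n)) (t : Fin n → ℝ) :
    Matrix (Fin n) (Fin n) ℝ :=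
  Matrix.diagonal (fisherWeight G t *ᵥ 1) - fisherWeight G t

theorem isHermitian_fisherLaplacian {n : ℕ} (G : SimpleGraph (Fin n)) (t : Fin n → ℝ) :
    (fisherLaplacian G t).IsHermitian := by
  have h : (fisherWeight G t).IsHermitian := by
    ext i j
    have hd : deriv Real.sigmoid (t j - t i) = deriv Real.sigmoid (t i - t j) := by
      rw [Real.deriv_sigmoid, ← neg_sub (t i) (t j)]
      simp only [Real.sigmoid_neg]
      ring
    have ha : G.Adj j i ↔ G.Adj i j := G.adj_comm j i
    simp only [fisherWeight, conjTranspose_apply, of_apply, hd, star_trivial]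
    by_cases h : G.Adj i j
    · rw [if_pos h, if_pos (ha.2 h)]
    · rw [if_neg h, if_neg (mt ha.1 h)]
  exact (Matrix.isHermitian_diagonal _).sub h

/-- The potential `π(x | θ, i₀, j₀) = 𝕀(x ∈ Ω) |A| 𝓛†(x | θ) (e_{i₀} - e_{j₀})`, where `|A|` is the
number of edges. -/
noncomputable def potential {n d : ℕ} (G : SimpleGraph (Fin n)) (Ω : Set (Ctx d))
    (θ : Scores n d) (i₀ j₀ : Fin n) (x : Ctx d) : Fin n → ℝ :=
  (Ω.indicator (fun _ => (1 : ℝ)) x * (G.edgeSet.ncard : ℝ)) •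
    (pinv (fisherLaplacian G (θ x)) *ᵥ (Pi.single i₀ 1 - Pi.single j₀ 1))

/-! ### The contextual BTL model -/

/-- The pairs of items `(i, j)` with `i > j`. -/
abbrev ItemPair (n : ℕ) : Type := {e : Fin n × Fin n // e.2 < e.1}

/-- A comparison graph together with `L` (context, outcome) records for every pair of items; the
outcome is `true` if the item `i` of the pair `(i, j)` is preferred. -/
abbrev Dataset (n L d : ℕ) : Type :=
  SimpleGraph (Fin n) × (ItemPair n → Fin L → Ctx d × Bool)

open Classical in
/-- What is observed: the comparison graph, and the records of its edges only (the records of the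
pairs that are not compared are overwritten by a fixed dummy value). -/
noncomputable def observed {n L d : ℕ} (D : Dataset n L d) : Dataset n L d :=
  (D.1, fun e ℓ => if D.1.Adj e.1.1 e.1.2 then D.2 e ℓ else (0, false))

/-- The random comparison graph `A`, the contexts `Z e ℓ` and outcomes `Y e ℓ` of the `ℓ`th
comparison of the pair `e`, and the fresh context `X` follow the contextual BTL model with
Erdős–Rényi comparison graph: connection probability `p`, context law `μ` supported on `𝕏`, and
true scores `θstar`. -/
structure IsContextualBTL {n L d : ℕ} {S : Type*} [MeasurableSpace S] (P : Measure S)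
    (p : I) (𝕏 : Set (Ctx d)) (μ : Measure (Ctx d)) (θstar : Scores n d)
    (A : S → SimpleGraph (Fin n)) (Z : ItemPair n → Fin L → S → Ctx d)
    (Y : ItemPair n → Fin L → S → Bool) (X : S → Ctx d) : Prop where
  measurable_graph : Measurable A
  measurable_ctx : ∀ e ℓ, Measurable (Z e ℓ)
  measurable_outcome : ∀ e ℓ, Measurable (Y e ℓ)
  measurable_fresh : Measurable X
  measurable_score : Measurable θstar
  ctx_mem : ∀ᵐ x ∂μ, x ∈ 𝕏
  /-- The comparison graph is an Erdős–Rényi graph. -/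
  law_graph : HasLaw A (SimpleGraph.binomialRandom (Fin n) p) P
  law_ctx : ∀ e ℓ, HasLaw (Z e ℓ) μ P
  law_fresh : HasLaw X μ P
  /-- Given its context `x`, item `i` is preferred with probability `ψ(θ*_i(x) - θ*_j(x))`. -/
  law_outcome : ∀ e ℓ, ∀ U : Set (Ctx d), MeasurableSet U →
    P {s | Z e ℓ s ∈ U ∧ Y e ℓ s = true} =
      ∫⁻ x in U, ENNReal.ofReal (Real.sigmoid (θstar x e.1.1 - θstar x e.1.2)) ∂μ
  indep_records : iIndepFun (fun (q : ItemPair n × Fin L) s => (Z q.1 q.2 s, Y q.1 q.2 s)) P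
  indep_graph : IndepFun A (fun s e ℓ => ((Z e ℓ s, Y e ℓ s) : Ctx d × Bool)) P
  indep_fresh :
    IndepFun X (fun s => observed ((A s, fun e ℓ => (Z e ℓ s, Y e ℓ s)) : Dataset n L d)) P

/-! ### The estimator -/

open Classical in
/-- The empirical negative log-likelihood of the scores `θ`. -/
noncomputable def negLogLik {n L d : ℕ} (p : ℝ) (D : Dataset n L d) (θ : Scores n d) : ℝ :=
  -(1 / ((n : ℝ) ^ 2 * p * L)) *
    ∑ e : ItemPair n, if D.1.Adj e.1.1 e.1.2 then
      ∑ ℓ : Fin L,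
        (let x := (D.2 e ℓ).1
         let y : ℝ := if (D.2 e ℓ).2 = true then 1 else 0
         y * Real.log (Real.sigmoid (θ x e.1.1 - θ x e.1.2)) +
          (1 - y) * Real.log (1 - Real.sigmoid (θ x e.1.1 - θ x e.1.2)))
    else 0

/-- The class `𝓖(𝓕ⁿ) = {ϑ - n⁻¹ 1 1ᵀ ϑ : ϑ ∈ 𝓕ⁿ ∩ Θ}`. -/
def normalizedClass (n : ℕ) {d : ℕ} (B : ℝ) (𝕏 : Set (Ctx d)) (𝓕 : Set (Ctx d → ℝ)) :
    Set (Scores n d) :=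
  {θ | ∃ ϑ : Scores n d, (∀ i, (fun x => ϑ x i) ∈ 𝓕) ∧ ϑ ∈ scoreClass n d B 𝕏 ∧
    θ = fun x i => ϑ x i - (1 / (n : ℝ)) * ∑ j, ϑ x j}

/-- `θ` minimizes the empirical negative log-likelihood over `𝓖(𝓕ⁿ)`. -/
def IsScoreEstimate {n L d : ℕ} (p B : ℝ) (𝕏 : Set (Ctx d)) (𝓕 : Set (Ctx d → ℝ))
    (D : Dataset n L d) (θ : Scores n d) : Prop :=
  θ ∈ normalizedClass n B 𝕏 𝓕 ∧ IsMinOn (negLogLik p D) (normalizedClass n B 𝕏 𝓕) θ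

/-! ### Errors conditional on the comparison graph -/

/-- `𝓔₂(f, g | A = G) = n⁻¹ 𝔼(‖f - g‖₂² | A = G)`. -/
noncomputable def condL2Error {n : ℕ} {S : Type*} [MeasurableSpace S] (P : Measure S)
    (A : S → SimpleGraph (Fin n)) (G : SimpleGraph (Fin n)) (f g : S → Fin n → ℝ) : ℝ≥0∞ :=
  (n : ℝ≥0∞)⁻¹ *
    ∫⁻ s, ENNReal.ofReal (∑ i, (f s i - g s i) ^ 2) ∂(ProbabilityTheory.cond P (A ⁻¹' {G}))

/-- The `L₂` error of the potentials given `A = G`, uniform over the pairs `(i₀, j₀)` and the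
domains `Ω ⊆ 𝕏`. -/
noncomputable def unifPotentialError {n d : ℕ} {S : Type*} [MeasurableSpace S] (P : Measure S)
    (𝕏 : Set (Ctx d)) (A : S → SimpleGraph (Fin n)) (X : S → Ctx d) (θhat : S → Scores n d)
    (θstar : Scores n d) (G : SimpleGraph (Fin n)) : ℝ≥0∞ :=
  ⨆ (i₀ : Fin n) (j₀ : Fin n) (Ω : Set (Ctx d)) (_ : MeasurableSet Ω) (_ : Ω ⊆ 𝕏),
    condL2Error P A G (fun s => potential (A s) Ω (θhat s) i₀ j₀ (X s))
      (fun s => potential (A s) Ω θstar i₀ j₀ (X s))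

/-- `𝓔_∞(θhat, θstar | A = G) = 𝔼(‖θhat(X) - θstar(X)‖_∞² | A = G)`; the norm of `Fin n → ℝ` is the
max norm. -/
noncomputable def condMaxError {n d : ℕ} {S : Type*} [MeasurableSpace S] (P : Measure S)
    (A : S → SimpleGraph (Fin n)) (X : S → Ctx d) (θhat : S → Scores n d)
    (θstar : Scores n d) (G : SimpleGraph (Fin n)) : ℝ≥0∞ :=
  ∫⁻ s, ENNReal.ofReal (‖θhat s (X s) - θstar (X s)‖ ^ 2)
    ∂(ProbabilityTheory.cond P (A ⁻¹' {G}))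

end FisherWalk

/-! The statement is deterministic once the comparison graph is a good expander. Scores in [-B, B]
give edge weights ψ'(θ_i - θ_j) between κ = ψ(-2B)² and 1, and these weights are Lipschitz in the
scores. Suppose mean-zero vectors satisfy ‖f‖² ≤ R·E(f), where E is the unweighted Dirichlet energy
of the graph. For b = e_{i₀} - e_{j₀}, let v and u solve the Laplacian equations 𝓛v = b and 𝓛'u = b
for two score vectors. Then 𝓛(v - u) = (𝓛' - 𝓛)u, and energy estimates give ‖v - u‖ ≲ R·δ·‖b‖/κ²,
where δ bounds the change of the weights (`sum_sq_pinv_sub_le`).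

The factor R comes from a Cheeger argument (`poincare_of_expansion`): maximal degree D and edge
expansion h yield R = D/h². Chernoff and union bounds (`binomialRandom_expanders`) show that D = 3np
and h = np/20 are admissible with probability at least 1 - 4/n, so R is of order 1/(np).

As |A| is of order at most n²p on this event, p cancels in |A|·R and a factor n remains. Squaring
and dividing by n leaves n times the squared max-norm error of the scores. The bound is pointwise in
the context and uniform in i₀, j₀ and Ω, so integrating it conditionally on the graph finishes the
proof. -/

namespace FisherWalk

/-! ### A Cheeger-type Poincaré inequality for weighted graphs -/

section Poincare

variable {V : Type*} [Fintype V]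

/-- The Dirichlet energy, each unordered pair being counted twice. -/
def energy (a : V → V → ℝ) (f : V → ℝ) : ℝ := ∑ i, ∑ j, a i j * (f i - f j) ^ 2

theorem energy_nonneg {a : V → V → ℝ} (ha : ∀ i j, 0 ≤ a i j) (f : V → ℝ) : 0 ≤ energy a f :=
  Finset.sum_nonneg fun i _ => Finset.sum_nonneg fun j _ => mul_nonneg (ha i j) (sq_nonneg _)

/-- Cauchy–Schwarz for double sums with nonnegative weights. -/
theorem sq_weighted_sum_le {a : V → V → ℝ} (ha : ∀ i j, 0 ≤ a i j) (x y : V → V → ℝ) :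
    (∑ i, ∑ j, a i j * (x i j * y i j)) ^ 2 ≤
      (∑ i, ∑ j, a i j * x i j ^ 2) * ∑ i, ∑ j, a i j * y i j ^ 2 := by
  simp only [← Fintype.sum_prod_type' (f := fun i j => a i j * (x i j * y i j)),
    ← Fintype.sum_prod_type' (f := fun i j => a i j * x i j ^ 2),
    ← Fintype.sum_prod_type' (f := fun i j => a i j * y i j ^ 2)]
  refine Finset.sum_sq_le_sum_mul_sum_of_sq_le_mul _
    (fun q _ => mul_nonneg (ha _ _) (sq_nonneg _)) (fun q _ => mul_nonneg (ha _ _) (sq_nonneg _))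
    fun q _ => le_of_eq (by ring)

/-- Take the largest value of f with at most half of the points strictly below it. If more than half
lay strictly above, the next larger value would still have fewer than half below it, contradicting
maximality. -/
theorem exists_median [Nonempty V] (f : V → ℝ) :
    ∃ m, 2 * (Finset.univ.filter fun i => m < f i).card ≤ Fintype.card V ∧
      2 * (Finset.univ.filter fun i => f i < m).card ≤ Fintype.card V := by
  classical
  set Q := Finset.univ.filter fun k =>
    2 * (Finset.univ.filter fun i => f i < f k).card ≤ Fintype.card V with hQ
  have hne : Q.Nonempty := by
    obtain ⟨k, -, hk⟩ := Finset.univ.exists_min_image f Finset.univ_nonempty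
    refine ⟨k, Finset.mem_filter.2 ⟨Finset.mem_univ _, ?_⟩⟩
    rw [Finset.filter_false_of_mem fun i hi => not_lt.2 (hk i hi)]
    simp
  obtain ⟨k, hk, hmax⟩ := Q.exists_max_image f hne
  refine ⟨f k, ?_, (Finset.mem_filter.1 hk).2⟩
  by_contra! hlt
  set U := Finset.univ.filter fun i => f k < f i with hU
  have hUne : U.Nonempty := Finset.card_pos.1 (by omega)
  obtain ⟨l, hl, hmin⟩ := U.exists_min_image f hUne
  have hsub : (Finset.univ.filter fun i => f i < f l) ⊆ Uᶜ := fun i hi => by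
    rw [Finset.mem_compl]
    exact fun hiU => absurd (hmin i hiU) (not_le.2 (Finset.mem_filter.1 hi).2)
  have hc := Finset.card_le_card hsub
  rw [Finset.card_compl] at hc
  have hlQ : l ∈ Q := Finset.mem_filter.2 ⟨Finset.mem_univ _, by omega⟩
  exact absurd (hmax l hlQ) (not_le.2 (Finset.mem_filter.1 hl).2)

variable [DecidableEq V]

/-- The co-area inequality: cuts of small sets control the total variation of functions with small
support. -/
theorem coarea_le {a : V → V → ℝ} (hsymm : ∀ i j, a i j = a j i) {h : ℝ}
    (hcut : ∀ S : Finset V, 2 * S.card ≤ Fintype.card V →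
      h * S.card ≤ ∑ i ∈ S, ∑ j ∈ Sᶜ, a i j) (g : V → ℝ) (hg : ∀ i, 0 ≤ g i)
    (hsupp : 2 * (Finset.univ.filter fun i => 0 < g i).card ≤ Fintype.card V) :
    2 * h * ∑ i, g i ≤ ∑ i, ∑ j, a i j * |g i - g j| := by
  -- Layer-cake argument by induction on the support size: lowering g on its support S by its least
  -- positive value m shrinks the support and removes exactly 2m times the cut of S from the total
  -- variation.
  induction hk : (Finset.univ.filter fun i => 0 < g i).card using Nat.strong_induction_on
    generalizing g with
  | _ k ih =>
  set S := Finset.univ.filter fun i => 0 < g i with hS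
  have memS : ∀ i, i ∈ S ↔ 0 < g i := fun i => by simp [hS]
  have zero_of : ∀ i, i ∉ S → g i = 0 := fun i hi =>
    le_antisymm (not_lt.1 fun h => hi ((memS i).2 h)) (hg i)
  rcases S.eq_empty_or_nonempty with he | hne
  · have : ∀ i, g i = 0 := fun i => zero_of i (by simp [he])
    simp [this]
  obtain ⟨k₀, hk₀, hmin⟩ := S.exists_min_image g hne
  set m := g k₀
  have hm : 0 < m := (memS k₀).1 hk₀
  set g' : V → ℝ := fun i => if i ∈ S then g i - m else 0 with hg'
  have hg'0 : ∀ i, 0 ≤ g' i := fun i => by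
    by_cases hi : i ∈ S
    · simpa [hg', hi] using hmin i hi
    · simp [hg', hi]
  have hss : (Finset.univ.filter fun i => 0 < g' i) ⊂ S := by
    refine (Finset.ssubset_iff_of_subset ?_).2 ⟨k₀, hk₀, ?_⟩
    · intro i hi
      by_contra hn
      simp [hg', hn] at hi
    · simp [hg', m]
  have hlt := Finset.card_lt_card hss
  have h1 := ih _ (hk ▸ hlt) g' hg'0 (by omega) rfl
  have hc := hcut S hsupp
  have hsum : ∑ i, g i = ∑ i, g' i + m * S.card := by
    have : ∀ i, g i = g' i + if i ∈ S then m else 0 := fun i => by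
      by_cases hi : i ∈ S
      · simp [hg', hi]
      · simp [hg', hi, zero_of i hi]
    rw [Finset.sum_congr rfl fun i _ => this i, Finset.sum_add_distrib]
    simp [mul_comm]
  have habs : ∀ i j, a i j * |g i - g j| = a i j * |g' i - g' j| +
      (m * (if i ∈ S then if j ∈ Sᶜ then a i j else 0 else 0) +
        m * (if j ∈ S then if i ∈ Sᶜ then a j i else 0 else 0)) := by
    intro i j
    by_cases hi : i ∈ S <;> by_cases hj : j ∈ S
    · simp [hg', hi, hj]
    · have := hmin i hi
      simp only [hg', hi, hj, zero_of j hj, Finset.mem_compl, if_true, if_false, not_true,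
        not_false_iff, sub_zero]
      rw [abs_of_nonneg (hg i), abs_of_nonneg (by linarith)]; ring
    · have := hmin j hj
      simp only [hg', hi, hj, zero_of i hi, Finset.mem_compl, if_true, if_false, not_true,
        not_false_iff, zero_sub, abs_neg, hsymm i j]
      rw [abs_of_nonneg (hg j), abs_of_nonneg (by linarith)]; ring
    · simp [hg', hi, hj, zero_of i hi, zero_of j hj]
  have hcutsum : ∑ i, ∑ j, (if i ∈ S then if j ∈ Sᶜ then a i j else 0 else 0) =
      ∑ i ∈ S, ∑ j ∈ Sᶜ, a i j := by
    rw [← Finset.sum_filter_add_sum_filter_not Finset.univ (· ∈ S)]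
    rw [Finset.sum_eq_zero (s := Finset.univ.filter fun i => i ∉ S), add_zero]
    · rw [Finset.filter_mem_eq_inter, Finset.univ_inter]
      refine Finset.sum_congr rfl fun i hi => ?_
      simp only [hi, if_true]
      rw [← Finset.sum_filter, Finset.filter_mem_eq_inter, Finset.univ_inter]
    · intro i hi
      simp [(Finset.mem_filter.1 hi).2]
  have htv : ∑ i, ∑ j, a i j * |g i - g j| = ∑ i, ∑ j, a i j * |g' i - g' j| +
      2 * m * ∑ i ∈ S, ∑ j ∈ Sᶜ, a i j := by
    simp only [habs, Finset.sum_add_distrib, ← Finset.mul_sum]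
    rw [Finset.sum_comm (f := fun i j => if j ∈ S then if i ∈ Sᶜ then a j i else 0 else 0),
      hcutsum]
    ring
  rw [htv, hsum]
  nlinarith [mul_le_mul_of_nonneg_left hc hm.le]

/-- Cheeger's argument. The co-area inequality for g² bounds 2hN, with N = ∑ g², by the total
variation of g². Factoring g_i² - g_j² = (g_i - g_j)(g_i + g_j), Cauchy–Schwarz bounds the square of
that variation by the energy times 4DN. Dividing by 4N gives the claim. -/
theorem sum_sq_le_energy_of_small_support {a : V → V → ℝ} (ha : ∀ i j, 0 ≤ a i j)
    (hsymm : ∀ i j, a i j = a j i) {h D : ℝ} (hh : 0 < h)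
    (hcut : ∀ S : Finset V, 2 * S.card ≤ Fintype.card V →
      h * S.card ≤ ∑ i ∈ S, ∑ j ∈ Sᶜ, a i j)
    (hdeg : ∀ i, ∑ j, a i j ≤ D) (g : V → ℝ) (hg : ∀ i, 0 ≤ g i)
    (hsupp : 2 * (Finset.univ.filter fun i => 0 < g i).card ≤ Fintype.card V) :
    h ^ 2 * ∑ i, g i ^ 2 ≤ D * energy a g := by
  have hE := energy_nonneg ha g
  set N := ∑ i, g i ^ 2 with hN
  have hN0 : 0 ≤ N := Finset.sum_nonneg fun i _ => sq_nonneg _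
  rcases hN0.eq_or_lt with h0 | hNpos
  · rw [← h0, mul_zero]
    rcases isEmpty_or_nonempty V with hV | ⟨⟨v⟩⟩
    · simp [energy]
    · exact mul_nonneg ((Finset.sum_nonneg fun j _ => ha v j).trans (hdeg v)) hE
  have hco := coarea_le hsymm hcut (fun i => g i ^ 2) (fun i => sq_nonneg _) (by
    have : ∀ i, 0 < g i ^ 2 ↔ 0 < g i := fun i =>
      ⟨fun hi => (hg i).lt_of_ne fun h0 => by simp [← h0] at hi, fun hi => by positivity⟩
    simpa only [this] using hsupp)
  have hfac : ∀ i j, |g i ^ 2 - g j ^ 2| = |g i - g j| * (g i + g j) := fun i j => by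
    rw [← abs_of_nonneg (add_nonneg (hg i) (hg j)), ← abs_mul]
    congr 1; ring
  have hcs := sq_weighted_sum_le ha (fun i j => |g i - g j|) (fun i j => g i + g j)
  simp only [← hfac, sq_abs] at hcs
  have hplus : ∑ i, ∑ j, a i j * (g i + g j) ^ 2 ≤ 4 * D * N := by
    have hrow : ∑ i, ∑ j, a i j * g i ^ 2 ≤ D * N := by
      rw [hN, Finset.mul_sum]
      refine Finset.sum_le_sum fun i _ => ?_
      rw [← Finset.sum_mul]
      exact mul_le_mul_of_nonneg_right (hdeg i) (sq_nonneg _)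
    have hcol : ∑ i, ∑ j, a i j * g j ^ 2 = ∑ i, ∑ j, a i j * g i ^ 2 := by
      rw [Finset.sum_comm]
      exact Finset.sum_congr rfl fun i _ => Finset.sum_congr rfl fun j _ => by rw [hsymm]
    have : ∑ i, ∑ j, a i j * (g i + g j) ^ 2 ≤
        ∑ i, ∑ j, (2 * (a i j * g i ^ 2) + 2 * (a i j * g j ^ 2)) :=
      Finset.sum_le_sum fun i _ => Finset.sum_le_sum fun j _ => by
        nlinarith [mul_nonneg (ha i j) (sq_nonneg (g i - g j))]
    simp only [Finset.sum_add_distrib, ← Finset.mul_sum] at this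
    linarith
  change 2 * h * N ≤ _ at hco
  set TV := ∑ i, ∑ j, a i j * |g i ^ 2 - g j ^ 2|
  change TV ^ 2 ≤ energy a g * _ at hcs
  have h1 : (2 * h * N) ^ 2 ≤ TV ^ 2 := pow_le_pow_left₀ (by positivity) hco 2
  have h2 : energy a g * ∑ i, ∑ j, a i j * (g i + g j) ^ 2 ≤ energy a g * (4 * D * N) :=
    mul_le_mul_of_nonneg_left hplus hE
  refine le_of_mul_le_mul_right ?_ (by positivity : 0 < 4 * N)
  nlinarith

/-- A Poincaré inequality with a constant given by the edge expansion and the maximal degree. -/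
theorem poincare_of_expansion [Nonempty V] {a : V → V → ℝ} (ha : ∀ i j, 0 ≤ a i j)
    (hsymm : ∀ i j, a i j = a j i) {h D : ℝ} (hh : 0 < h)
    (hcut : ∀ S : Finset V, 2 * S.card ≤ Fintype.card V →
      h * S.card ≤ ∑ i ∈ S, ∑ j ∈ Sᶜ, a i j)
    (hdeg : ∀ i, ∑ j, a i j ≤ D) (f : V → ℝ) (hf : ∑ i, f i = 0) :
    ∑ i, f i ^ 2 ≤ D / h ^ 2 * energy a f := by
  have hD : 0 ≤ D := by
    obtain ⟨v⟩ := ‹Nonempty V›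
    exact (Finset.sum_nonneg fun j _ => ha v j).trans (hdeg v)
  -- Centering at a median makes the positive and negative parts of f - m each supported on at most
  -- half of the points.
  obtain ⟨m, hup, hlo⟩ := exists_median f
  have h1 := sum_sq_le_energy_of_small_support ha hsymm hh hcut hdeg
    (fun i => max (f i - m) 0) (fun i => le_max_right _ _) (by simpa using hup)
  have h2 := sum_sq_le_energy_of_small_support ha hsymm hh hcut hdeg
    (fun i => max (m - f i) 0) (fun i => le_max_right _ _) (by simpa using hlo)
  have hE : energy a (fun i => max (f i - m) 0) + energy a (fun i => max (m - f i) 0) ≤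
      energy a f := by
    simp only [energy, ← Finset.sum_add_distrib, ← mul_add]
    refine Finset.sum_le_sum fun i _ => Finset.sum_le_sum fun j _ =>
      mul_le_mul_of_nonneg_left ?_ (ha i j)
    rcases le_total (f i) m with hi | hi <;> rcases le_total (f j) m with hj | hj
    · rw [max_eq_right (by linarith), max_eq_right (by linarith), max_eq_left (by linarith),
        max_eq_left (by linarith)]
      nlinarith
    · rw [max_eq_right (by linarith), max_eq_left (by linarith), max_eq_left (by linarith),
        max_eq_right (by linarith)]
      nlinarith
    · rw [max_eq_left (by linarith), max_eq_right (by linarith), max_eq_right (by linarith),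
        max_eq_left (by linarith)]
      nlinarith
    · rw [max_eq_left (by linarith), max_eq_left (by linarith), max_eq_right (by linarith),
        max_eq_right (by linarith)]
      nlinarith
  -- As f has mean zero, shifting by m can only increase the sum of squares.
  have hsq : ∑ i, f i ^ 2 ≤ ∑ i, max (f i - m) 0 ^ 2 + ∑ i, max (m - f i) 0 ^ 2 := by
    have : ∀ i, max (f i - m) 0 ^ 2 + max (m - f i) 0 ^ 2 = f i ^ 2 - 2 * m * f i + m ^ 2 := by
      intro i
      rcases le_total (f i) m with hi | hi
      · rw [max_eq_right (by linarith), max_eq_left (by linarith)]; ring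
      · rw [max_eq_left (by linarith), max_eq_right (by linarith)]; ring
    rw [← Finset.sum_add_distrib, Finset.sum_congr rfl fun i _ => this i, Finset.sum_add_distrib,
      Finset.sum_sub_distrib, ← Finset.mul_sum, hf]
    simp only [mul_zero, sub_zero, le_add_iff_nonneg_right]
    exact Finset.sum_nonneg fun _ _ => sq_nonneg _
  have hh2 : 0 < h ^ 2 := by positivity
  rw [div_mul_eq_mul_div, le_div_iff₀ hh2]
  nlinarith [mul_le_mul_of_nonneg_left hE hD, mul_le_mul_of_nonneg_left hsq hh2.le]

end Poincare

/-! ### Stability of the Moore–Penrose inverse of a weighted Laplacian -/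

section Laplacian

variable {n : ℕ}

open Classical in
/-- The adjacency indicators of a graph. -/
noncomputable def adjIndicator {V : Type*} (G : SimpleGraph V) (i j : V) : ℝ :=
  if G.Adj i j then 1 else 0

theorem adjIndicator_nonneg {V : Type*} (G : SimpleGraph V) (i j : V) :
    0 ≤ adjIndicator G i j := by
  unfold adjIndicator; split_ifs <;> norm_num

theorem adjIndicator_symm {V : Type*} (G : SimpleGraph V) (i j : V) :
    adjIndicator G i j = adjIndicator G j i := by
  by_cases h : G.Adj i j
  · simp [adjIndicator, h, h.symm]
  · simp [adjIndicator, h, mt G.adj_symm h]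

theorem fisherWeight_apply (G : SimpleGraph (Fin n)) (t : Fin n → ℝ) (i j : Fin n) :
    fisherWeight G t i j = adjIndicator G i j * deriv Real.sigmoid (t i - t j) := by
  simp [fisherWeight, adjIndicator]

theorem deriv_sigmoid_neg (x : ℝ) : deriv Real.sigmoid (-x) = deriv Real.sigmoid x := by
  simp only [Real.deriv_sigmoid, Real.sigmoid_neg]; ring

theorem fisherWeight_symm (G : SimpleGraph (Fin n)) (t : Fin n → ℝ) (i j : Fin n) :
    fisherWeight G t i j = fisherWeight G t j i := by
  rw [fisherWeight_apply, fisherWeight_apply, adjIndicator_symm, ← deriv_sigmoid_neg, neg_sub]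

theorem fisherLaplacian_mulVec (G : SimpleGraph (Fin n)) (t x : Fin n → ℝ) (i : Fin n) :
    (fisherLaplacian G t *ᵥ x) i = ∑ j, fisherWeight G t i j * (x i - x j) := by
  rw [fisherLaplacian, Matrix.sub_mulVec, Pi.sub_apply, Matrix.mulVec_diagonal]
  simp only [Matrix.mulVec, dotProduct, Pi.one_apply, mul_one, mul_sub, Finset.sum_sub_distrib,
    Finset.sum_mul]

theorem dotProduct_fisherLaplacian_mulVec (G : SimpleGraph (Fin n)) (t x y : Fin n → ℝ) :
    2 * (y ⬝ᵥ (fisherLaplacian G t *ᵥ x)) =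
      ∑ i, ∑ j, fisherWeight G t i j * ((y i - y j) * (x i - x j)) := by
  have h1 : y ⬝ᵥ (fisherLaplacian G t *ᵥ x) =
      ∑ i, ∑ j, fisherWeight G t i j * (y i * (x i - x j)) := by
    simp only [dotProduct, fisherLaplacian_mulVec, Finset.mul_sum]
    exact Finset.sum_congr rfl fun i _ => Finset.sum_congr rfl fun j _ => by ring
  have h2 : y ⬝ᵥ (fisherLaplacian G t *ᵥ x) =
      ∑ i, ∑ j, fisherWeight G t i j * (y j * (x j - x i)) := by
    rw [h1, Finset.sum_comm]
    exact Finset.sum_congr rfl fun i _ => Finset.sum_congr rfl fun j _ => by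
      rw [fisherWeight_symm]
  rw [two_mul]
  nth_rewrite 1 [h1]
  rw [h2]
  simp only [← Finset.sum_add_distrib]
  exact Finset.sum_congr rfl fun i _ => Finset.sum_congr rfl fun j _ => by ring

theorem sum_fisherLaplacian_mulVec (G : SimpleGraph (Fin n)) (t x : Fin n → ℝ) :
    ∑ i, (fisherLaplacian G t *ᵥ x) i = 0 := by
  have h := dotProduct_fisherLaplacian_mulVec G t x 1
  simpa [dotProduct] using h

theorem energy_le_dotProduct (G : SimpleGraph (Fin n)) {t : Fin n → ℝ} {κ : ℝ}
    (hκ : ∀ i j, κ ≤ deriv Real.sigmoid (t i - t j)) (x : Fin n → ℝ) :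
    κ * energy (adjIndicator G) x ≤ 2 * (x ⬝ᵥ (fisherLaplacian G t *ᵥ x)) := by
  rw [dotProduct_fisherLaplacian_mulVec, energy, Finset.mul_sum]
  refine Finset.sum_le_sum fun i _ => ?_
  rw [Finset.mul_sum]
  refine Finset.sum_le_sum fun j _ => ?_
  rw [fisherWeight_apply]
  nlinarith [mul_le_mul_of_nonneg_left (hκ i j)
    (mul_nonneg (adjIndicator_nonneg G i j) (sq_nonneg (x i - x j)))]

/-- By the Penrose equations and symmetry, 𝓛† = 𝓛(𝓛†ᵀ𝓛†), so the range of 𝓛† lies in that of 𝓛,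
which consists of mean-zero vectors. -/
theorem sum_pinv_mulVec (G : SimpleGraph (Fin n)) (t b : Fin n → ℝ) :
    ∑ i, (pinv (fisherLaplacian G t) *ᵥ b) i = 0 := by
  have hM := isMoorePenrose_pinv (isHermitian_fisherLaplacian G t)
  have hT : (fisherLaplacian G t)ᵀ = fisherLaplacian G t := by
    simpa [Matrix.IsHermitian, conjTranspose_eq_transpose_of_trivial]
      using isHermitian_fisherLaplacian G t
  have h : pinv (fisherLaplacian G t) = fisherLaplacian G t *
      ((pinv (fisherLaplacian G t))ᵀ * pinv (fisherLaplacian G t)) := by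
    conv_lhs => rw [← hM.mul_mul_right, ← hM.symm_right, Matrix.transpose_mul, hT]
    rw [Matrix.mul_assoc]
  rw [h, ← Matrix.mulVec_mulVec]
  exact sum_fisherLaplacian_mulVec G t _

/-- The residual b - 𝓛𝓛†b has mean zero and is annihilated by 𝓛. Its energy is therefore zero, and
the Poincaré inequality forces it to vanish. -/
theorem fisherLaplacian_mulVec_pinv_mulVec (G : SimpleGraph (Fin n)) {t : Fin n → ℝ} {κ R : ℝ}
    (hκ0 : 0 < κ) (hκ : ∀ i j, κ ≤ deriv Real.sigmoid (t i - t j)) (hR : 0 ≤ R)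
    (hpoin : ∀ f : Fin n → ℝ, ∑ i, f i = 0 → ∑ i, f i ^ 2 ≤ R * energy (adjIndicator G) f)
    {b : Fin n → ℝ} (hb : ∑ i, b i = 0) :
    fisherLaplacian G t *ᵥ (pinv (fisherLaplacian G t) *ᵥ b) = b := by
  have hM := isMoorePenrose_pinv (isHermitian_fisherLaplacian G t)
  have hT : (fisherLaplacian G t)ᵀ = fisherLaplacian G t := by
    simpa [Matrix.IsHermitian, conjTranspose_eq_transpose_of_trivial]
      using isHermitian_fisherLaplacian G t
  have hLL : fisherLaplacian G t * (fisherLaplacian G t * pinv (fisherLaplacian G t)) =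
      fisherLaplacian G t := by
    have := congrArg Matrix.transpose hM.mul_mul_left
    rwa [Matrix.transpose_mul, hM.symm_left, hT] at this
  set r := b - fisherLaplacian G t *ᵥ (pinv (fisherLaplacian G t) *ᵥ b) with hr
  have hLr : fisherLaplacian G t *ᵥ r = 0 := by
    rw [hr, Matrix.mulVec_sub, Matrix.mulVec_mulVec, Matrix.mulVec_mulVec, Matrix.mul_assoc,
      hLL, sub_self]
  have hsum : ∑ i, r i = 0 := by
    simp only [hr, Pi.sub_apply, Finset.sum_sub_distrib, hb, sum_fisherLaplacian_mulVec, sub_zero]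
  have hE := energy_le_dotProduct G hκ r
  rw [hLr, dotProduct_zero, mul_zero] at hE
  have hE0 : energy (adjIndicator G) r ≤ 0 := by
    by_contra! h
    nlinarith [mul_pos hκ0 h]
  have hsq : ∑ i, r i ^ 2 ≤ 0 := (hpoin r hsum).trans (mul_nonpos_of_nonneg_of_nonpos hR hE0)
  have hr0 : r = 0 := by
    funext i
    have := (Finset.sum_eq_zero_iff_of_nonneg fun i _ => sq_nonneg (r i)).1
      (le_antisymm hsq (Finset.sum_nonneg fun _ _ => sq_nonneg _)) i (Finset.mem_univ i)
    simpa using this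
  rw [hr, sub_eq_zero] at hr0
  exact hr0.symm

theorem sum_sq_pinv_sub_le (G : SimpleGraph (Fin n)) {t t' : Fin n → ℝ} {κ R δ : ℝ}
    (hκ0 : 0 < κ) (hκ : ∀ i j, κ ≤ deriv Real.sigmoid (t i - t j))
    (hκ' : ∀ i j, κ ≤ deriv Real.sigmoid (t' i - t' j)) (hR : 0 ≤ R)
    (hδ : ∀ i j, |deriv Real.sigmoid (t i - t j) - deriv Real.sigmoid (t' i - t' j)| ≤ δ)
    (hpoin : ∀ f : Fin n → ℝ, ∑ i, f i = 0 → ∑ i, f i ^ 2 ≤ R * energy (adjIndicator G) f)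
    {b : Fin n → ℝ} (hb : ∑ i, b i = 0) :
    κ ^ 4 * ∑ i, ((pinv (fisherLaplacian G t) *ᵥ b) i - (pinv (fisherLaplacian G t') *ᵥ b) i) ^ 2 ≤
      4 * R ^ 2 * δ ^ 2 * ∑ i, b i ^ 2 := by
  set v := pinv (fisherLaplacian G t) *ᵥ b with hv
  set u := pinv (fisherLaplacian G t') *ᵥ b with hu
  set w := v - u with hw
  have hLv : fisherLaplacian G t *ᵥ v = b :=
    fisherLaplacian_mulVec_pinv_mulVec G hκ0 hκ hR hpoin hb
  have hLu : fisherLaplacian G t' *ᵥ u = b :=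
    fisherLaplacian_mulVec_pinv_mulVec G hκ0 hκ' hR hpoin hb
  have hsu : ∑ i, u i = 0 := sum_pinv_mulVec G t' b
  have hsw : ∑ i, w i = 0 := by
    simp only [hw, Pi.sub_apply, Finset.sum_sub_distrib, hsu, hv, sum_pinv_mulVec, sub_zero]
  have ha := adjIndicator_nonneg G
  set Eu := energy (adjIndicator G) u with hEu
  set Ew := energy (adjIndicator G) w with hEw
  have hEu0 : 0 ≤ Eu := energy_nonneg ha u
  have hEw0 : 0 ≤ Ew := energy_nonneg ha w
  set β := ∑ i, b i ^ 2 with hβ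
  have hβ0 : 0 ≤ β := Finset.sum_nonneg fun _ _ => sq_nonneg _
  -- Test 𝓛'u = b against u: κE(u) ≤ 2⟨u, b⟩ ≤ 2‖u‖‖b‖, and ‖u‖² ≤ R·E(u). Square and cancel one
  -- factor E(u).
  have hu1 : κ ^ 2 * Eu ≤ 4 * R * β := by
    have h1 := energy_le_dotProduct G hκ' u
    rw [hLu] at h1
    have h2 : (u ⬝ᵥ b) ^ 2 ≤ (∑ i, u i ^ 2) * β := Finset.sum_mul_sq_le_sq_mul_sq _ _ _
    have h3 := hpoin u hsu
    have h4 : (κ * Eu) ^ 2 ≤ (2 * (u ⬝ᵥ b)) ^ 2 := pow_le_pow_left₀ (by positivity) h1 2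
    have h5 : (∑ i, u i ^ 2) * β ≤ R * Eu * β := mul_le_mul_of_nonneg_right h3 hβ0
    rcases hEu0.eq_or_lt with h0 | hpos
    · rw [← h0, mul_zero]; positivity
    · refine le_of_mul_le_mul_right ?_ hpos
      nlinarith
  -- Test 𝓛w = (𝓛' - 𝓛)u against w. Cauchy–Schwarz over the edges keeps everything in terms of
  -- energies, so no operator norm of 𝓛' - 𝓛 is needed.
  have hw1 : κ ^ 2 * Ew ≤ δ ^ 2 * Eu := by
    have h1 := energy_le_dotProduct G hκ w
    have h2 : 2 * (w ⬝ᵥ (fisherLaplacian G t *ᵥ w)) =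
        ∑ i, ∑ j, adjIndicator G i j * (((deriv Real.sigmoid (t' i - t' j) -
          deriv Real.sigmoid (t i - t j)) * (w i - w j)) * (u i - u j)) := by
      have h3 : fisherLaplacian G t *ᵥ w =
          fisherLaplacian G t' *ᵥ u - fisherLaplacian G t *ᵥ u := by
        rw [hw, Matrix.mulVec_sub, hLv, hLu]
      rw [h3, dotProduct_sub, mul_sub, dotProduct_fisherLaplacian_mulVec,
        dotProduct_fisherLaplacian_mulVec]
      simp only [← Finset.sum_sub_distrib]
      refine Finset.sum_congr rfl fun i _ => Finset.sum_congr rfl fun j _ => ?_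
      rw [fisherWeight_apply, fisherWeight_apply]; ring
    have hcs := sq_weighted_sum_le ha (fun i j => (deriv Real.sigmoid (t' i - t' j) -
          deriv Real.sigmoid (t i - t j)) * (w i - w j)) (fun i j => u i - u j)
    rw [← h2] at hcs
    have h4 : ∑ i, ∑ j, adjIndicator G i j * ((deriv Real.sigmoid (t' i - t' j) -
          deriv Real.sigmoid (t i - t j)) * (w i - w j)) ^ 2 ≤ δ ^ 2 * Ew := by
      rw [hEw, energy, Finset.mul_sum]
      refine Finset.sum_le_sum fun i _ => ?_
      rw [Finset.mul_sum]
      refine Finset.sum_le_sum fun j _ => ?_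
      have h5 : (deriv Real.sigmoid (t' i - t' j) - deriv Real.sigmoid (t i - t j)) ^ 2 ≤ δ ^ 2 := by
        rw [← sq_abs, abs_sub_comm]
        exact pow_le_pow_left₀ (abs_nonneg _) (hδ i j) 2
      have := mul_le_mul_of_nonneg_right h5 (mul_nonneg (ha i j) (sq_nonneg (w i - w j)))
      nlinarith
    have h6 : (κ * Ew) ^ 2 ≤ δ ^ 2 * Ew * Eu :=
      (pow_le_pow_left₀ (by positivity) h1 2).trans
        (hcs.trans (mul_le_mul_of_nonneg_right h4 hEu0))
    rcases hEw0.eq_or_lt with h0 | hpos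
    · rw [← h0, mul_zero]; positivity
    · refine le_of_mul_le_mul_right ?_ hpos
      nlinarith
  have hfin := hpoin w hsw
  calc κ ^ 4 * ∑ i, (v i - u i) ^ 2 ≤ κ ^ 4 * (R * Ew) :=
        mul_le_mul_of_nonneg_left hfin (by positivity)
    _ = R * κ ^ 2 * (κ ^ 2 * Ew) := by ring
    _ ≤ R * κ ^ 2 * (δ ^ 2 * Eu) := mul_le_mul_of_nonneg_left hw1 (by positivity)
    _ = R * δ ^ 2 * (κ ^ 2 * Eu) := by ring
    _ ≤ R * δ ^ 2 * (4 * R * β) := mul_le_mul_of_nonneg_left hu1 (by positivity)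
    _ = 4 * R ^ 2 * δ ^ 2 * β := by ring

end Laplacian

/-! ### The derivative of the logistic function -/

theorem le_deriv_sigmoid {c x : ℝ} (hx : |x| ≤ c) :
    Real.sigmoid (-c) ^ 2 ≤ deriv Real.sigmoid x := by
  obtain ⟨h1, h2⟩ := abs_le.1 hx
  have e1 := Real.sigmoid_le h1
  have e2 : Real.sigmoid (-c) ≤ Real.sigmoid (-x) := Real.sigmoid_le (by linarith)
  rw [Real.sigmoid_neg x] at e2
  rw [Real.deriv_sigmoid, sq]
  exact mul_le_mul e1 e2 (Real.sigmoid_nonneg _) (Real.sigmoid_nonneg _)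

theorem abs_sigmoid_sub_le (x y : ℝ) : |Real.sigmoid x - Real.sigmoid y| ≤ |x - y| := by
  have := Convex.norm_image_sub_le_of_norm_deriv_le (f := Real.sigmoid) (s := Set.univ) (C := 1)
    (x := y) (y := x) (fun z _ => differentiableAt_sigmoid) (fun z _ => by
      have h1 := Real.sigmoid_nonneg z
      have h2 := Real.sigmoid_le_one z
      rw [Real.deriv_sigmoid, Real.norm_eq_abs, abs_of_nonneg (mul_nonneg h1 (by linarith))]
      nlinarith) convex_univ (Set.mem_univ _) (Set.mem_univ _)
  simpa using this

/-- Since ψ' = ψ(1 - ψ), the difference factors as (ψ(x) - ψ(y))(1 - ψ(x) - ψ(y)), whose second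
factor lies in [-1, 1]. -/
theorem abs_deriv_sigmoid_sub_le (x y : ℝ) :
    |deriv Real.sigmoid x - deriv Real.sigmoid y| ≤ |x - y| := by
  have h : deriv Real.sigmoid x - deriv Real.sigmoid y =
      (Real.sigmoid x - Real.sigmoid y) * (1 - Real.sigmoid x - Real.sigmoid y) := by
    simp only [Real.deriv_sigmoid]; ring
  rw [h, abs_mul]
  have h1 : |1 - Real.sigmoid x - Real.sigmoid y| ≤ 1 := by
    rw [abs_le]
    constructor <;> linarith [Real.sigmoid_nonneg x, Real.sigmoid_nonneg y,
      Real.sigmoid_le_one x, Real.sigmoid_le_one y]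
  exact (mul_le_of_le_one_right (abs_nonneg _) h1).trans (abs_sigmoid_sub_le x y)

/-! ### Edge counts of binomial random graphs -/

-- Memberships are independent, so the expectation factors. An element outside u is never selected,
-- and its factor is 1.
open Classical in
theorem integral_prod_setBernoulli {ι : Type*} [Fintype ι] (u : Set ι) (p : I) (g : ι → ℝ) :
    ∫ s, ∏ i, (if i ∈ s then g i else 1) ∂(setBernoulli u p) =
      ∏ i, ((p : ℝ) * (if i ∈ u then g i else 1) + (1 - p)) := by
  rw [setBernoulli_eq_map, Measure.infinitePi_eq_pi, integral_map (by fun_prop)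
    (Measurable.of_discrete.aestronglyMeasurable)]
  simp only [Set.mem_ofPred_eq]
  rw [integral_fintype_prod_eq_prod (f := fun i (x : Prop) => if x then g i else 1)]
  refine Finset.prod_congr rfl fun i _ => ?_
  rw [integral_add_measure .of_finite .of_finite]
  simp [NNReal.smul_def]

instance {V : Type*} [Countable V] : MeasurableSingletonClass (SimpleGraph V) where
  measurableSet_singleton G := by
    have h := SimpleGraph.measurable_edgeSet (V := V) (measurableSet_singleton G.edgeSet)
    convert h
    ext H
    simp

-- Injectivity of Q into unordered pairs makes the indicators independent; excluding loops makes
-- each one Bernoulli(p).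
open Classical in
theorem integral_exp_sum_adjIndicator {V : Type*} [Fintype V] (p : I) (t : ℝ)
    (Q : Finset (V × V)) (hQ : Set.InjOn (fun q : V × V => s(q.1, q.2)) Q)
    (hd : ∀ q ∈ Q, q.1 ≠ q.2) :
    ∫ G, Real.exp (t * ∑ q ∈ Q, adjIndicator G q.1 q.2) ∂(SimpleGraph.binomialRandom V p) =
      ((p : ℝ) * Real.exp t + (1 - p)) ^ Q.card := by
  have key : ∀ s : Set (Sym2 V),
      Real.exp (t * ∑ q ∈ Q, adjIndicator (SimpleGraph.fromEdgeSet s) q.1 q.2) =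
        ∏ e, (if e ∈ s then (if e ∈ Q.image fun q : V × V => s(q.1, q.2) then Real.exp t else 1)
          else 1) := by
    intro s
    have h1 : ∀ e : Sym2 V, (if e ∈ s then
        (if e ∈ Q.image fun q : V × V => s(q.1, q.2) then Real.exp t else 1) else 1) =
        if e ∈ Q.image fun q : V × V => s(q.1, q.2) then (if e ∈ s then Real.exp t else 1)
        else 1 := fun e => by split_ifs <;> rfl
    rw [Finset.prod_congr rfl fun e _ => h1 e, ← Finset.prod_filter, Finset.filter_mem_eq_inter,
      Finset.univ_inter, Finset.prod_image hQ, Finset.mul_sum, Real.exp_sum]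
    refine Finset.prod_congr rfl fun q hq => ?_
    by_cases h : s(q.1, q.2) ∈ s <;> simp [adjIndicator, h, hd q hq]
  rw [SimpleGraph.binomialRandom_eq_map, integral_map (by fun_prop)
    (Measurable.of_discrete.aestronglyMeasurable)]
  simp only [key]
  rw [integral_prod_setBernoulli]
  trans ∏ e, if e ∈ Q.image fun q : V × V => s(q.1, q.2) then (p : ℝ) * Real.exp t + (1 - p) else 1
  · refine Finset.prod_congr rfl fun e _ => ?_
    by_cases he : e ∈ Q.image fun q : V × V => s(q.1, q.2)
    · obtain ⟨q, hq, rfl⟩ := Finset.mem_image.1 he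
      simp only [he, if_true]
      rw [if_pos (by simpa using hd q hq)]
    · simp [he]
  · rw [← Finset.prod_filter, Finset.filter_mem_eq_inter, Finset.univ_inter, Finset.prod_const,
      Finset.card_image_of_injOn hQ]

/-- The Chernoff bound for the number of edges within a set of pairs; `t` may have either sign. -/
theorem binomialRandom_chernoff {V : Type*} [Fintype V] (p : I) (t b : ℝ)
    (Q : Finset (V × V)) (hQ : Set.InjOn (fun q : V × V => s(q.1, q.2)) Q)
    (hd : ∀ q ∈ Q, q.1 ≠ q.2) :
    (SimpleGraph.binomialRandom V p).real {G | b ≤ t * ∑ q ∈ Q, adjIndicator G q.1 q.2} ≤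
      Real.exp (-b + Q.card * p * (Real.exp t - 1)) := by
  have h1 := measure_ge_le_exp_mul_mgf (μ := SimpleGraph.binomialRandom V p)
    (X := fun G => t * ∑ q ∈ Q, adjIndicator G q.1 q.2) (t := 1) b zero_le_one .of_finite
  simp only [mgf, one_mul] at h1
  rw [integral_exp_sum_adjIndicator p t Q hQ hd] at h1
  refine h1.trans ?_
  rw [Real.exp_add, neg_one_mul]
  refine mul_le_mul_of_nonneg_left ?_ (Real.exp_pos _).le
  rw [mul_assoc, Real.exp_nat_mul]
  have hp0 : 0 ≤ (p : ℝ) := p.2.1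
  have hp1 : (p : ℝ) ≤ 1 := p.2.2
  refine pow_le_pow_left₀ (add_nonneg (mul_nonneg hp0 (Real.exp_pos _).le) (by linarith)) ?_ _
  -- 1 + x ≤ eˣ replaces the binomial moment generating function by the Poisson one.
  have := Real.add_one_le_exp ((p : ℝ) * (Real.exp t - 1))
  linarith

/-- Chernoff with t = 1 and e - 1 ≤ 2: the exponent is at most -3np + 2np = -np ≤ -2 log n. -/
theorem binomialRandom_degree_tail {n : ℕ} (p : I)
    (hnp : 40 * Real.log (n : ℝ) ≤ (n : ℝ) * (p : ℝ)) (i : Fin n) :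
    (SimpleGraph.binomialRandom (Fin n) p).real {G | 3 * ((n : ℝ) * p) ≤ ∑ j, adjIndicator G i j} ≤
      1 / (n : ℝ) ^ 2 := by
  have hn : 0 < (n : ℝ) := by exact_mod_cast i.pos
  have hlog : 0 ≤ Real.log (n : ℝ) := Real.log_nonneg (by exact_mod_cast i.pos)
  set Q : Finset (Fin n × Fin n) := (Finset.univ.erase i).image fun j => (i, j) with hQ
  have hinj : Function.Injective fun j : Fin n => (i, j) := fun j k h => (Prod.mk.inj h).2
  have hsum : ∀ G : SimpleGraph (Fin n),
      ∑ q ∈ Q, adjIndicator G q.1 q.2 = ∑ j, adjIndicator G i j := fun G => by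
    rw [hQ, Finset.sum_image hinj.injOn, Finset.sum_erase]
    simp [adjIndicator]
  have h := binomialRandom_chernoff p 1 (3 * (n * p)) Q (by
    intro q hq r hr h
    simp only [hQ, Finset.coe_image, Set.mem_image, Finset.mem_coe] at hq hr
    obtain ⟨j, -, rfl⟩ := hq
    obtain ⟨k, -, rfl⟩ := hr
    rcases Sym2.eq_iff.1 h with h | h
    · exact Prod.ext h.1 h.2
    · exact Prod.ext rfl (h.2.trans h.1)) (by
    intro q hq
    obtain ⟨j, hj, rfl⟩ := Finset.mem_image.1 hq
    exact (Finset.ne_of_mem_erase hj).symm)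
  simp only [hsum, one_mul] at h
  refine h.trans ?_
  have hcard : (Q.card : ℝ) ≤ n := by
    rw [hQ, Finset.card_image_of_injective _ hinj]
    exact_mod_cast (Finset.card_le_univ _).trans_eq (Fintype.card_fin n)
  have he := Real.exp_one_lt_d9
  have he' := Real.exp_one_gt_d9
  have hp0 : 0 ≤ (p : ℝ) := p.2.1
  rw [one_div, ← Real.exp_log (show 0 < ((n : ℝ) ^ 2)⁻¹ by positivity), Real.log_inv, Real.log_pow]
  refine Real.exp_le_exp.2 ?_
  have h1 : Q.card * (p : ℝ) * (Real.exp 1 - 1) ≤ n * p * 2 := by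
    refine mul_le_mul (mul_le_mul_of_nonneg_right hcard hp0) (by linarith) (by linarith)
      (by positivity)
  push_cast
  linarith

/-- Chernoff with t = -1. The cut has at least n|S|/2 pairs and e⁻¹ - 1 ≤ -1/2, so the exponent is
at most (1/20 - 1/4)np|S| = -np|S|/5 ≤ -8|S| log n. The decay in |S| pays for the union over all S.
-/
theorem binomialRandom_cut_tail {n : ℕ} (p : I)
    (hnp : 40 * Real.log (n : ℝ) ≤ (n : ℝ) * (p : ℝ)) (S : Finset (Fin n)) (hn0 : 0 < n)
    (hS : 2 * S.card ≤ n) :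
    (SimpleGraph.binomialRandom (Fin n) p).real
      {G | ∑ i ∈ S, ∑ j ∈ Sᶜ, adjIndicator G i j ≤ (n : ℝ) * p / 20 * S.card} ≤
      (1 / (n : ℝ) ^ 2) ^ S.card := by
  have hn : 0 < (n : ℝ) := by exact_mod_cast hn0
  have hlog : 0 ≤ Real.log (n : ℝ) := Real.log_nonneg (by exact_mod_cast hn0)
  have hp0 : 0 ≤ (p : ℝ) := p.2.1
  have h := binomialRandom_chernoff p (-1) (-(n * p / 20 * S.card)) (S ×ˢ Sᶜ) (by
    rintro ⟨i, j⟩ hq ⟨k, l⟩ hr h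
    simp only [Finset.coe_product, Set.mem_prod, Finset.mem_coe, Finset.mem_compl] at hq hr
    rcases Sym2.eq_iff.1 h with h | h
    · exact Prod.ext h.1 h.2
    · obtain rfl : i = l := h.1
      exact absurd hq.1 hr.2) (by
    rintro ⟨i, j⟩ hq h
    simp only [Finset.mem_product, Finset.mem_compl] at hq
    obtain rfl : i = j := h
    exact hq.2 hq.1)
  simp only [Finset.sum_product, neg_one_mul, neg_le_neg_iff, neg_neg] at h
  refine h.trans ?_
  have hcard : (n : ℝ) / 2 * S.card ≤ ((S ×ˢ Sᶜ).card : ℝ) := by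
    have h2 : (n : ℝ) / 2 ≤ (Sᶜ.card : ℝ) := by
      have h3 : n ≤ 2 * Sᶜ.card := by
        rw [Finset.card_compl, Fintype.card_fin]; omega
      have : (n : ℝ) ≤ 2 * Sᶜ.card := by exact_mod_cast h3
      linarith
    rw [Finset.card_product]
    push_cast
    nlinarith [mul_le_mul_of_nonneg_left h2 (Nat.cast_nonneg (α := ℝ) S.card)]
  have he : Real.exp (-1) ≤ 1 / 2 := by
    rw [Real.exp_neg, one_div]
    exact inv_anti₀ (by norm_num) (by linarith [Real.exp_one_gt_d9])
  rw [one_div, ← Real.exp_log (show 0 < ((n : ℝ) ^ 2)⁻¹ by positivity), Real.log_inv, Real.log_pow,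
    ← Real.exp_nat_mul]
  refine Real.exp_le_exp.2 ?_
  have hs : (0 : ℝ) ≤ S.card := Nat.cast_nonneg _
  have h1 : ((S ×ˢ Sᶜ).card : ℝ) * p * (Real.exp (-1) - 1) ≤ n / 2 * S.card * p * (-1 / 2) := by
    have h3 : ((S ×ˢ Sᶜ).card : ℝ) * p * (Real.exp (-1) - 1) ≤
        ((S ×ˢ Sᶜ).card : ℝ) * p * (-1 / 2) :=
      mul_le_mul_of_nonneg_left (by linarith) (by positivity)
    have h4 := mul_le_mul_of_nonneg_right hcard hp0
    linarith
  have h5 := mul_le_mul_of_nonneg_left hnp hs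
  push_cast
  nlinarith [mul_nonneg hs hlog]

/-- Graphs with maximal degree at most `3 n p` and edge expansion at least `n p / 20`. -/
def expanders (n : ℕ) (p : ℝ) : Set (SimpleGraph (Fin n)) :=
  {G | (∀ i, ∑ j, adjIndicator G i j ≤ 3 * (n * p)) ∧
    ∀ S : Finset (Fin n), 2 * S.card ≤ n →
      n * p / 20 * S.card ≤ ∑ i ∈ S, ∑ j ∈ Sᶜ, adjIndicator G i j}

theorem binomialRandom_expanders {n : ℕ} (hn0 : 0 < n) (p : I)
    (hnp : 40 * Real.log (n : ℝ) ≤ (n : ℝ) * (p : ℝ)) :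
    1 - 4 / (n : ℝ) ≤ (SimpleGraph.binomialRandom (Fin n) p).real (expanders n p) := by
  have hn : 1 ≤ (n : ℝ) := by exact_mod_cast hn0
  set ν := SimpleGraph.binomialRandom (Fin n) p
  set 𝒮 : Finset (Finset (Fin n)) := Finset.univ.filter fun S => S.Nonempty ∧ 2 * S.card ≤ n with h𝒮
  have hsub : (expanders n p)ᶜ ⊆
      (⋃ i ∈ (Finset.univ : Finset (Fin n)),
        {G : SimpleGraph (Fin n) | 3 * ((n : ℝ) * p) ≤ ∑ j, adjIndicator G i j}) ∪
      ⋃ S ∈ 𝒮, {G : SimpleGraph (Fin n) |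
        ∑ i ∈ S, ∑ j ∈ Sᶜ, adjIndicator G i j ≤ (n : ℝ) * p / 20 * S.card} := by
    intro G hG
    by_contra hcon
    simp only [Set.mem_union, Set.mem_iUnion, not_or, not_exists] at hcon
    refine hG ⟨fun i => le_of_not_ge fun h => hcon.1 i (Finset.mem_univ i) h, fun S hS => ?_⟩
    rcases S.eq_empty_or_nonempty with rfl | hne
    · simp
    · exact le_of_not_ge fun h => hcon.2 S (Finset.mem_filter.2 ⟨Finset.mem_univ _, hne, hS⟩) h
  have h1 : ν.real (⋃ i ∈ (Finset.univ : Finset (Fin n)),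
      {G : SimpleGraph (Fin n) | 3 * ((n : ℝ) * p) ≤ ∑ j, adjIndicator G i j}) ≤ 1 / n := by
    refine (measureReal_biUnion_finset_le _ _).trans
      ((Finset.sum_le_sum fun i _ => binomialRandom_degree_tail p hnp i).trans_eq ?_)
    simp only [Finset.sum_const, Finset.card_univ, Fintype.card_fin, nsmul_eq_mul]
    field_simp
  have h2 : ν.real (⋃ S ∈ 𝒮, {G : SimpleGraph (Fin n) |
      ∑ i ∈ S, ∑ j ∈ Sᶜ, adjIndicator G i j ≤ (n : ℝ) * p / 20 * S.card}) ≤ 2 / n := by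
    refine (measureReal_biUnion_finset_le _ _).trans
      ((Finset.sum_le_sum fun S hS =>
        binomialRandom_cut_tail p hnp S hn0 (Finset.mem_filter.1 hS).2.2).trans ?_)
    have h3 : ∑ S ∈ 𝒮, (1 / (n : ℝ) ^ 2) ^ S.card ≤
        ∑ S ∈ Finset.univ.erase (∅ : Finset (Fin n)), (1 / (n : ℝ) ^ 2) ^ S.card :=
      Finset.sum_le_sum_of_subset_of_nonneg (fun S hS => Finset.mem_erase.2
        ⟨(Finset.mem_filter.1 hS).2.1.ne_empty, Finset.mem_univ _⟩) fun _ _ _ => by positivity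
    -- The union bound is summed exactly by the binomial theorem. Without the empty set it is at
    -- most e^{1/n} - 1 ≤ 2/n.
    have h4 : ∑ S : Finset (Fin n), (1 / (n : ℝ) ^ 2) ^ S.card = (1 / (n : ℝ) ^ 2 + 1) ^ n := by
      have := Fintype.sum_pow_mul_eq_add_pow (Fin n) (1 / (n : ℝ) ^ 2) 1
      simpa using this
    have h5 : (1 / (n : ℝ) ^ 2 + 1) ^ n ≤ Real.exp (1 / n) := by
      refine (pow_le_pow_left₀ (by positivity) (Real.add_one_le_exp _) n).trans_eq ?_
      rw [← Real.exp_nat_mul]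
      congr 1
      field_simp
    have h6 : |1 / (n : ℝ)| ≤ 1 := by
      rw [abs_of_nonneg (by positivity), div_le_one (by positivity)]
      exact hn
    have h7 := (abs_le.1 (Real.abs_exp_sub_one_le h6)).2
    rw [abs_of_nonneg (by positivity)] at h7
    rw [← Finset.add_sum_erase _ _ (Finset.mem_univ ∅), Finset.card_empty, pow_zero] at h4
    have h8 : 2 * (1 / (n : ℝ)) = 2 / n := by ring
    linarith
  have h3 := (measureReal_mono hsub).trans ((measureReal_union_le _ _).trans (add_le_add h1 h2))
  rw [measureReal_compl (Set.toFinite _).measurableSet, probReal_univ] at h3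
  have h4 : 1 / (n : ℝ) + 2 / n ≤ 4 / n := by
    rw [← add_div]
    exact div_le_div_of_nonneg_right (by norm_num) (by positivity)
  linarith

/-! ### Potentials on expanding comparison graphs -/

theorem ncard_edgeSet_le {n : ℕ} {p : ℝ} {G : SimpleGraph (Fin n)} (hG : G ∈ expanders n p) :
    (G.edgeSet.ncard : ℝ) ≤ 3 / 2 * n ^ 2 * p := by
  classical
  have h1 := G.sum_degrees_eq_twice_card_edges
  have h2 : ∀ i, (G.degree i : ℝ) = ∑ j, adjIndicator G i j := fun i => by
    simp only [adjIndicator, Finset.sum_boole, ← G.card_neighborFinset_eq_degree,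
      G.neighborFinset_eq_filter]
  have h3 : (2 * G.edgeSet.ncard : ℝ) = ∑ i, ∑ j, adjIndicator G i j := by
    simp only [← h2]
    rw [← Nat.cast_sum, h1, ← SimpleGraph.coe_edgeFinset, Set.ncard_coe_finset]
    push_cast
    rfl
  have h4 : ∑ i, ∑ j, adjIndicator G i j ≤ ∑ _i : Fin n, 3 * (n * p) :=
    Finset.sum_le_sum fun i _ => hG.1 i
  simp only [Finset.sum_const, Finset.card_univ, Fintype.card_fin, nsmul_eq_mul] at h4
  linarith

theorem poincare_of_mem_expanders {n : ℕ} (hn : 0 < n) {p : ℝ} (hp : 0 < p)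
    {G : SimpleGraph (Fin n)} (hG : G ∈ expanders n p) (f : Fin n → ℝ) (hf : ∑ i, f i = 0) :
    ∑ i, f i ^ 2 ≤ 1200 / (n * p) * energy (adjIndicator G) f := by
  have : Nonempty (Fin n) := ⟨⟨0, hn⟩⟩
  have hn' : 0 < (n : ℝ) := by exact_mod_cast hn
  have h := poincare_of_expansion (adjIndicator_nonneg G) (adjIndicator_symm G)
    (h := n * p / 20) (D := 3 * (n * p)) (by positivity) (by simpa using hG.2) hG.1 f hf
  have e : 3 * (n * p) / (n * p / 20) ^ 2 = 1200 / (n * p) := by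
    field_simp
    norm_num
  rwa [e] at h

/-- The stability estimate with R = 1200/(np), δ = 2‖θ - θ'‖_∞ and ‖b‖² ≤ 4, multiplied by |A|² ≤
(3n²p/2)². The constant is 144 = (9/4)·4·4·4, and κ⁴ = ψ(-2B)⁸. -/
theorem sum_sq_potential_sub_le {n d : ℕ} (hn : 0 < n) {p B : ℝ} (hp : 0 < p)
    {G : SimpleGraph (Fin n)} (hG : G ∈ expanders n p) {Ω : Set (Ctx d)} {θ θ' : Scores n d}
    {x : Ctx d} (hθ : x ∈ Ω → ∀ i, θ x i ∈ Set.Icc (-B) B)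
    (hθ' : x ∈ Ω → ∀ i, θ' x i ∈ Set.Icc (-B) B) (i₀ j₀ : Fin n) :
    (n : ℝ)⁻¹ * ∑ i, (potential G Ω θ i₀ j₀ x i - potential G Ω θ' i₀ j₀ x i) ^ 2 ≤
      144 * 1200 ^ 2 / Real.sigmoid (-(2 * B)) ^ 8 * n * ‖θ x - θ' x‖ ^ 2 := by
  have hn' : 0 < (n : ℝ) := by exact_mod_cast hn
  set κ := Real.sigmoid (-(2 * B)) ^ 2 with hκ
  have hκ0 : 0 < κ := pow_pos (Real.sigmoid_pos _) 2
  have hκ8 : Real.sigmoid (-(2 * B)) ^ 8 = κ ^ 4 := by rw [hκ]; ring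
  rw [hκ8]
  -- Off Ω both potentials vanish, so bounds on the scores are needed on Ω alone.
  by_cases hx : x ∈ Ω
  swap
  · simp only [potential, Set.indicator_of_notMem hx, zero_mul, zero_smul, Pi.zero_apply, sub_zero]
    simp only [ne_eq, OfNat.ofNat_ne_zero, not_false_eq_true, zero_pow, Finset.sum_const_zero,
      mul_zero]
    positivity
  have hdiff : ∀ {t : Fin n → ℝ}, (∀ i, t i ∈ Set.Icc (-B) B) → ∀ i j,
      κ ≤ deriv Real.sigmoid (t i - t j) := fun ht i j =>
    le_deriv_sigmoid (abs_le.2 ⟨by linarith [(ht i).1, (ht j).2], by linarith [(ht i).2, (ht j).1]⟩)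
  have hδ : ∀ i j, |deriv Real.sigmoid (θ x i - θ x j) - deriv Real.sigmoid (θ' x i - θ' x j)| ≤
      2 * ‖θ x - θ' x‖ := fun i j => by
    refine (abs_deriv_sigmoid_sub_le _ _).trans ?_
    have h1 := norm_le_pi_norm (θ x - θ' x) i
    have h2 := norm_le_pi_norm (θ x - θ' x) j
    rw [Pi.sub_apply, Real.norm_eq_abs] at h1 h2
    rw [show θ x i - θ x j - (θ' x i - θ' x j) = (θ x i - θ' x i) - (θ x j - θ' x j) by ring]
    linarith [abs_sub (θ x i - θ' x i) (θ x j - θ' x j)]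
  set b : Fin n → ℝ := Pi.single i₀ 1 - Pi.single j₀ 1 with hb
  have hb0 : ∑ i, b i = 0 := by simp [hb, Finset.sum_sub_distrib]
  have hb2 : ∑ i, b i ^ 2 ≤ 4 := by
    have h1 : ∀ i, b i ^ 2 ≤ 2 * (Pi.single i₀ (1 : ℝ) : Fin n → ℝ) i +
        2 * (Pi.single j₀ (1 : ℝ) : Fin n → ℝ) i := fun i => by
      simp only [hb, Pi.sub_apply, Pi.single_apply]
      split_ifs <;> norm_num
    refine (Finset.sum_le_sum fun i _ => h1 i).trans_eq ?_
    simp only [Finset.sum_add_distrib, ← Finset.mul_sum, Finset.sum_pi_single', Finset.mem_univ,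
      if_true]
    norm_num
  have key := sum_sq_pinv_sub_le G hκ0 (hdiff (hθ hx)) (hdiff (hθ' hx))
    (R := 1200 / (n * p)) (by positivity) hδ (poincare_of_mem_expanders hn hp hG) hb0
  have hE := ncard_edgeSet_le hG
  set N := (G.edgeSet.ncard : ℝ)
  have hN0 : 0 ≤ N := Nat.cast_nonneg _
  have hpot : ∑ i, (potential G Ω θ i₀ j₀ x i - potential G Ω θ' i₀ j₀ x i) ^ 2 =
      N ^ 2 * ∑ i, ((pinv (fisherLaplacian G (θ x)) *ᵥ b) i -
        (pinv (fisherLaplacian G (θ' x)) *ᵥ b) i) ^ 2 := by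
    rw [Finset.mul_sum]
    refine Finset.sum_congr rfl fun i _ => ?_
    simp only [potential, Set.indicator_of_mem hx, one_mul, Pi.smul_apply, smul_eq_mul]
    ring
  rw [hpot]
  set W := ∑ i, ((pinv (fisherLaplacian G (θ x)) *ᵥ b) i -
        (pinv (fisherLaplacian G (θ' x)) *ᵥ b) i) ^ 2
  set η := ‖θ x - θ' x‖
  have hN2 : N ^ 2 ≤ (3 / 2 * n ^ 2 * p) ^ 2 := pow_le_pow_left₀ hN0 hE 2
  have hW : W ≤ 4 * (1200 / (n * p)) ^ 2 * (2 * η) ^ 2 * 4 / κ ^ 4 := by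
    rw [le_div_iff₀ (by positivity), mul_comm]
    exact key.trans (mul_le_mul_of_nonneg_left hb2 (by positivity))
  have hW0 : 0 ≤ W := Finset.sum_nonneg fun _ _ => sq_nonneg _
  calc (n : ℝ)⁻¹ * (N ^ 2 * W) ≤ (n : ℝ)⁻¹ * ((3 / 2 * n ^ 2 * p) ^ 2 *
        (4 * (1200 / (n * p)) ^ 2 * (2 * η) ^ 2 * 4 / κ ^ 4)) := by gcongr
    _ = 144 * 1200 ^ 2 / κ ^ 4 * n * η ^ 2 := by
      field_simp
      ring

/-- Members of Θ already sum to zero on 𝕏, so centering changes nothing there. -/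
theorem normalizedClass_subset_scoreClass {n d : ℕ} {B : ℝ} {𝕏 : Set (Ctx d)}
    {𝓕 : Set (Ctx d → ℝ)} {θ : Scores n d} (hθ : θ ∈ normalizedClass n B 𝕏 𝓕) :
    θ ∈ scoreClass n d B 𝕏 := by
  obtain ⟨ϑ, -, hϑ, rfl⟩ := hθ
  intro x hx
  simpa [(hϑ x hx).2] using hϑ x hx

theorem unifPotentialError_le {n d : ℕ} (hn : 0 < n) {p B : ℝ} (hp : 0 < p) {S : Type*}
    [MeasurableSpace S] {P : Measure S} {𝕏 : Set (Ctx d)} {A : S → SimpleGraph (Fin n)}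
    (hA : Measurable A) {X : S → Ctx d} {θhat : S → Scores n d} {θstar : Scores n d}
    (hhat : ∀ᵐ s ∂P, θhat s ∈ scoreClass n d B 𝕏) (hstar : θstar ∈ scoreClass n d B 𝕏)
    {G : SimpleGraph (Fin n)} (hG : G ∈ expanders n p) :
    unifPotentialError P 𝕏 A X θhat θstar G ≤
      ENNReal.ofReal (144 * 1200 ^ 2 / Real.sigmoid (-(2 * B)) ^ 8) * (n : ℝ≥0∞) *
        condMaxError P A X θhat θstar G := by
  refine iSup_le fun i₀ => iSup_le fun j₀ => iSup_le fun Ω => iSup_le fun _ => iSup_le fun hΩ => ?_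
  have hn' : 0 < (n : ℝ) := by exact_mod_cast hn
  set K := 144 * 1200 ^ 2 / Real.sigmoid (-(2 * B)) ^ 8
  have hK : 0 ≤ K := by
    have := Real.sigmoid_pos (-(2 * B))
    positivity
  -- Finite constants move inside the integral without measurability of the integrand, leaving a
  -- pointwise comparison.
  rw [condL2Error, condMaxError, ← lintegral_const_mul' _ _ (by simp [hn.ne']),
    ← lintegral_const_mul' _ _ (by simp [ENNReal.mul_eq_top])]
  have hgraph : ∀ᵐ s ∂(ProbabilityTheory.cond P (A ⁻¹' {G})), s ∈ A ⁻¹' {G} :=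
    ae_cond_mem (hA (measurableSet_singleton G))
  refine lintegral_mono_ae ?_
  filter_upwards [hgraph, cond_absolutelyContinuous.ae_le hhat] with s hs hθ
  obtain rfl : A s = G := hs
  have h := sum_sq_potential_sub_le (B := B) hn hp hG (x := X s) (θ := θhat s) (θ' := θstar)
    (fun hx => (hθ _ (hΩ hx)).1) (fun hx => (hstar _ (hΩ hx)).1) i₀ j₀
  have h' := ENNReal.ofReal_le_ofReal h
  rwa [ENNReal.ofReal_mul (by positivity), ENNReal.ofReal_inv_of_pos hn', ENNReal.ofReal_natCast,
    ENNReal.ofReal_mul (by positivity), ENNReal.ofReal_mul hK, ENNReal.ofReal_natCast] at h'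

end FisherWalk

theorem mainTheorem6 (B : ℝ) (hB : 0 < B) :
    ∃ K : ℝ, 0 < K ∧
      ∀ (n L d : ℕ), 0 < n → 0 < L →
      ∀ (p : unitInterval), 0 < (p : ℝ) → 40 * Real.log (n : ℝ) ≤ (n : ℝ) * (p : ℝ) →
      ∀ (𝕏 : Set (FisherWalk.Ctx d)), IsCompact 𝕏 →
      ∀ (μ : MeasureTheory.Measure (FisherWalk.Ctx d)),
      ∀ (S : Type*) [MeasurableSpace S] (P : MeasureTheory.Measure S)
        [MeasureTheory.IsProbabilityMeasure P]
        (θstar : FisherWalk.Scores n d)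
        (A : S → SimpleGraph (Fin n))
        (Z : FisherWalk.ItemPair n → Fin L → S → FisherWalk.Ctx d)
        (Y : FisherWalk.ItemPair n → Fin L → S → Bool)
        (X : S → FisherWalk.Ctx d),
        θstar ∈ FisherWalk.scoreClass n d B 𝕏 →
        FisherWalk.IsContextualBTL P p 𝕏 μ θstar A Z Y X →
      ∀ (𝓕 : Set (FisherWalk.Ctx d → ℝ))
        (T : FisherWalk.Dataset n L d → FisherWalk.Scores n d),
        Measurable (fun q : FisherWalk.Dataset n L d × FisherWalk.Ctx d => T q.1 q.2) →
      ∀ (θhat : S → FisherWalk.Scores n d),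
        (∀ s, θhat s = T (FisherWalk.observed (A s, fun e ℓ => (Z e ℓ s, Y e ℓ s)))) →
        (∀ᵐ s ∂P, FisherWalk.IsScoreEstimate (p : ℝ) B 𝕏 𝓕
          (FisherWalk.observed (A s, fun e ℓ => (Z e ℓ s, Y e ℓ s))) (θhat s)) →
        1 - 4 / (n : ℝ) ≤
          P.real {s | FisherWalk.unifPotentialError P 𝕏 A X θhat θstar (A s) ≤
            ENNReal.ofReal K * (n : ENNReal) *
              FisherWalk.condMaxError P A X θhat θstar (A s)} := by
  refine ⟨144 * 1200 ^ 2 / Real.sigmoid (-(2 * B)) ^ 8,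
    div_pos (by norm_num) (pow_pos (Real.sigmoid_pos _) 8), ?_⟩
  intro n L d hn _ p hp hnp 𝕏 _ μ S _ P _ θstar A Z Y X hstar hmodel 𝓕 T _ θhat _ hhat
  have hhat' : ∀ᵐ s ∂P, θhat s ∈ FisherWalk.scoreClass n d B 𝕏 :=
    hhat.mono fun s hs => FisherWalk.normalizedClass_subset_scoreClass hs.1
  refine (FisherWalk.binomialRandom_expanders hn p hnp).trans ?_
  -- The probability of expansion under the Erdős–Rényi law is pulled back along A; on that event
  -- the error bound is deterministic.
  rw [← hmodel.law_graph.map_eq, map_measureReal_apply hmodel.measurable_graph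
    (Set.toFinite _).measurableSet]
  exact measureReal_mono fun s hs =>
    FisherWalk.unifPotentialError_le hn hp hmodel.measurable_graph hhat' hstar hs
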